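/- Let $G=(V,E)$ be a finite connected graph of girth at least $6$ (that is, $G$ is simple and has no cycle of length $3$, $4$ or $5$; trees are allowed), with graph distance $d$, the length of a shortest path. For a positive weight $\omega:E\to(0,\infty)$ let $m(x)=\sum_{y\sim x}\omega_{xy}$, and for $\alpha\in(0,1)$ let $m_x^\alpha$ be the probability measure on $V$ with mass $\alpha$ at $x$, mass $(1-\alpha)\,\omega_{xy}/m(x)$ at each neighbour $y$ of $x$, and mass $0$ elsewhere. The Lin–Lu–Yau curvature of an edge $e=xy$ is $$\kappa_e(\omega)=\lim_{\alpha\to1^-}\frac1{1-\alpha}\Bigl(1-\frac{W(m_x^\alpha,m_y^\alpha)}{d(x,y)}\Bigr),$$ where $W$ is the Wasserstein distance with transport cost $d$. Let $\kappa^*:E\to\mathbb R$ be attainable, i.e. $\kappa(\omega')=\kappa^*$ for some positive weight $\omega'$. Then for every positive initial weight $\omega_0$ the prescribed-curvature flow $$\frac{d}{dt}\omega_e=-(\kappa_e(\omega)-\kappa^*_e)\,\omega_e\quad(e\in E),\qquad \omega(0)=\omega_0,$$ has a unique positive solution $\omega(t)$ on $[0,\infty)$; there is a unique positive weight $\omega^*$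 with $\kappa(\omega^*)=\kappa^*$ and $\sum_e\log\omega^*_e=\sum_e\log\omega_{0,e}$; and there are constants $C,\lambda>0$ with $$|\omega_e(t)-\omega^*_e|\le Ce^{-\lambda t}\quad\text{and}\quad|\kappa_e(\omega(t))-\kappa^*_e|\le Ce^{-\lambda t}\qquad\text{for all }t\ge0,\ e\in E.$$ -/

import Mathlib

namespace LinLuYau

open Filter Topology

variable {V : Type*}

open Classical in
/-- The edge weight `ω_{xy}`, extended by zero to the pairs that are not edges. -/
noncomputable def weight (G : SimpleGraph V) (ω : G.edgeSet → ℝ) (x y : V) : ℝ :=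
  if h : G.Adj x y then ω ⟨s(x, y), h⟩ else 0

lemma weight_nonneg {G : SimpleGraph V} {ω : G.edgeSet → ℝ} (hω : ∀ e, 0 < ω e) (x y : V) :
    0 ≤ weight G ω x y := by
  unfold weight
  split_ifs with h
  · exact (hω _).le
  · exact le_rfl

lemma weight_self (G : SimpleGraph V) (ω : G.edgeSet → ℝ) (x : V) : weight G ω x x = 0 := by
  simp [weight]

variable [Fintype V]

/-- The weighted degree `m(x) = ∑_{y ∼ x} ω_{xy}`. -/
noncomputable def wdeg (G : SimpleGraph V) (ω : G.edgeSet → ℝ) (x : V) : ℝ :=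
  ∑ y, weight G ω x y

open Classical in
/-- The lazy random walk measure `m_x^α`: mass `α` at `x` and mass `(1 - α) ω_{xy} / m(x)` at each
neighbour `y` of `x`. -/
noncomputable def lazyMeasure (G : SimpleGraph V) (ω : G.edgeSet → ℝ) (α : ℝ) (x y : V) : ℝ :=
  if y = x then α else (1 - α) * (weight G ω x y / wdeg G ω x)

/-- `A` is a transport plan from `μ` to `ν`. For probability vectors `μ`, `ν` the bound
`A u v ≤ 1` is automatic. -/
structure IsTransportPlan (μ ν : V → ℝ) (A : V → V → ℝ) : Prop where
  nonneg : ∀ u v, 0 ≤ A u v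
  fst : ∀ u, ∑ v, A u v = μ u
  snd : ∀ v, ∑ u, A u v = ν v

/-- The transport cost of `A` with respect to the combinatorial graph distance. -/
noncomputable def cost (G : SimpleGraph V) (A : V → V → ℝ) : ℝ :=
  ∑ u, ∑ v, (G.dist u v : ℝ) * A u v

/-- The Wasserstein distance with respect to the combinatorial graph distance. -/
noncomputable def wasserstein (G : SimpleGraph V) (μ ν : V → ℝ) : ℝ :=
  sInf {c | ∃ A, IsTransportPlan μ ν A ∧ c = cost G A}

/-- The quotient `(1 / (1 - α)) (1 - W(m_x^α, m_y^α) / d(x, y))`. -/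
noncomputable def curvatureQuotient (G : SimpleGraph V) (ω : G.edgeSet → ℝ) (x y : V) (α : ℝ) : ℝ :=
  1 / (1 - α) * (1 - wasserstein G (lazyMeasure G ω α x) (lazyMeasure G ω α y) / (G.dist x y : ℝ))

/-- The Lin–Lu–Yau curvature `κ(x, y)`, the limit of `curvatureQuotient` as `α → 1⁻`. For positive
weights on a connected graph this limit exists, see `tendsto_curvatureQuotient`. -/
noncomputable def curvature (G : SimpleGraph V) (ω : G.edgeSet → ℝ) (x y : V) : ℝ :=
  limUnder (𝓝[<] (1 : ℝ)) (curvatureQuotient G ω x y)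

lemma IsTransportPlan.swap {μ ν : V → ℝ} {A : V → V → ℝ} (h : IsTransportPlan μ ν A) :
    IsTransportPlan ν μ (fun u v => A v u) :=
  ⟨fun u v => h.nonneg v u, h.snd, h.fst⟩

lemma cost_swap (G : SimpleGraph V) (A : V → V → ℝ) :
    cost G (fun u v => A v u) = cost G A := by
  unfold cost
  rw [Finset.sum_comm]
  simp only [SimpleGraph.dist_comm]

lemma wasserstein_comm (G : SimpleGraph V) (μ ν : V → ℝ) :
    wasserstein G μ ν = wasserstein G ν μ := by
  unfold wasserstein
  congr 1
  ext c
  constructor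
  · rintro ⟨A, hA, rfl⟩
    exact ⟨_, hA.swap, (cost_swap G A).symm⟩
  · rintro ⟨A, hA, rfl⟩
    exact ⟨_, hA.swap, (cost_swap G A).symm⟩

lemma curvature_comm (G : SimpleGraph V) (ω : G.edgeSet → ℝ) (x y : V) :
    curvature G ω x y = curvature G ω y x := by
  unfold curvature
  congr 1
  ext α
  unfold curvatureQuotient
  rw [wasserstein_comm, SimpleGraph.dist_comm]

/-- The Lin–Lu–Yau curvature vector `κ(ω)`, indexed by the edges. -/
noncomputable def edgeCurvature (G : SimpleGraph V) (ω : G.edgeSet → ℝ) (e : G.edgeSet) : ℝ :=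
  Sym2.lift ⟨curvature G ω, curvature_comm G ω⟩ e.1

/-- `ω` is a positive solution on `[0, ∞)`, with initial value `ω₀`, of the Ricci flow
`dω_i/dt = -(κ_i(ω) - κ*_i) ω_i` with prescribed curvature `κ*`. -/
structure IsRicciFlow (G : SimpleGraph V) (κ' ω₀ : G.edgeSet → ℝ)
    (ω : ℝ → G.edgeSet → ℝ) : Prop where
  init : ω 0 = ω₀
  pos : ∀ t, 0 ≤ t → ∀ e, 0 < ω t e
  deriv : ∀ t, 0 ≤ t → ∀ e, HasDerivWithinAt (fun s => ω s e)
    (-(edgeCurvature G (ω t) e - κ' e) * ω t e) (Set.Ici 0) t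

/-- `ω` is a positive weight with curvature `κ'`. -/
def Realizes (G : SimpleGraph V) (κ' ω : G.edgeSet → ℝ) : Prop :=
  (∀ e, 0 < ω e) ∧ ∀ e, edgeCurvature G ω e = κ' e

/-- `κ'` is attainable: some positive weight has curvature `κ'`. -/
def IsAttainable (G : SimpleGraph V) (κ' : G.edgeSet → ℝ) : Prop :=
  ∃ ω, Realizes G κ' ω

/-- Exponential convergence of `u t` to `l` as `t → ∞`, in the sup norm over a finite index set. -/
def ConvergesExponentially {ι : Type*} (u : ℝ → ι → ℝ) (l : ι → ℝ) : Prop :=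
  ∃ C : ℝ, 0 < C ∧ ∃ r : ℝ, 0 < r ∧
    ∀ t, 0 ≤ t → ∀ i, |u t i - l i| ≤ C * Real.exp (-(r * t))

/-! The limit that defines the curvature exists. -/

lemma wdeg_pos {G : SimpleGraph V} {ω : G.edgeSet → ℝ} (hG : G.Connected)
    (hω : ∀ e, 0 < ω e) {x y : V} (hxy : x ≠ y) : 0 < wdeg G ω x := by
  have : Nontrivial V := ⟨x, y, hxy⟩
  obtain ⟨z, hz⟩ := hG.preconnected.exists_adj_of_nontrivial x
  have h : 0 < weight G ω x z := by
    unfold weight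
    rw [dif_pos hz]
    exact hω _
  exact h.trans_le (Finset.single_le_sum (fun v _ => weight_nonneg hω x v) (Finset.mem_univ z))

open Classical in
lemma lazyMeasure_eq (G : SimpleGraph V) (ω : G.edgeSet → ℝ) (α : ℝ) (x y : V) :
    lazyMeasure G ω α x y =
      α * (if y = x then 1 else 0) + (1 - α) * (weight G ω x y / wdeg G ω x) := by
  unfold lazyMeasure
  split_ifs with h
  · subst h
    simp [weight_self]
  · simp

lemma lazyMeasure_nonneg {G : SimpleGraph V} {ω : G.edgeSet → ℝ} (hω : ∀ e, 0 < ω e) {α : ℝ}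
    (h0 : 0 ≤ α) (h1 : α ≤ 1) (x y : V) : 0 ≤ lazyMeasure G ω α x y := by
  unfold lazyMeasure
  split_ifs
  · exact h0
  · exact mul_nonneg (by linarith) (div_nonneg (weight_nonneg hω x y)
      (Finset.sum_nonneg fun v _ => weight_nonneg hω x v))

lemma sum_lazyMeasure {G : SimpleGraph V} {ω : G.edgeSet → ℝ} (hG : G.Connected)
    (hω : ∀ e, 0 < ω e) (α : ℝ) {x y : V} (hxy : x ≠ y) : ∑ z, lazyMeasure G ω α x z = 1 := by
  classical
  simp only [lazyMeasure_eq, Finset.sum_add_distrib, ← Finset.mul_sum, ← Finset.sum_div]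
  have h : (∑ z, weight G ω x z) / wdeg G ω x = 1 := div_self (wdeg_pos hG hω hxy).ne'
  rw [h]
  simp

lemma cost_nonneg (G : SimpleGraph V) {μ ν : V → ℝ} {A : V → V → ℝ} (h : IsTransportPlan μ ν A) :
    0 ≤ cost G A :=
  Finset.sum_nonneg fun u _ => Finset.sum_nonneg fun v _ =>
    mul_nonneg (Nat.cast_nonneg _) (h.nonneg u v)

lemma wasserstein_le (G : SimpleGraph V) {μ ν : V → ℝ} {A : V → V → ℝ}
    (h : IsTransportPlan μ ν A) : wasserstein G μ ν ≤ cost G A :=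
  csInf_le ⟨0, by rintro c ⟨B, hB, rfl⟩; exact cost_nonneg G hB⟩ ⟨A, h, rfl⟩

lemma le_wasserstein (G : SimpleGraph V) {μ ν : V → ℝ} (hμ : ∀ u, 0 ≤ μ u) (hν : ∀ u, 0 ≤ ν u)
    (hμ1 : ∑ u, μ u = 1) (hν1 : ∑ u, ν u = 1) {c : ℝ}
    (h : ∀ A, IsTransportPlan μ ν A → c ≤ cost G A) : c ≤ wasserstein G μ ν := by
  refine le_csInf ⟨_, fun u v => μ u * ν v, ⟨fun u v => mul_nonneg (hμ u) (hν v), ?_, ?_⟩, rfl⟩ ?_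
  · intro u
    rw [← Finset.mul_sum, hν1, mul_one]
  · intro v
    rw [← Finset.sum_mul, hμ1, one_mul]
  · rintro b ⟨A, hA, rfl⟩
    exact h A hA

lemma wasserstein_lazy_le {G : SimpleGraph V} {ω : G.edgeSet → ℝ} (hG : G.Connected)
    (hω : ∀ e, 0 < ω e) {x y : V} (hxy : x ≠ y) {α β : ℝ} (h0 : 0 ≤ α) (hαβ : α ≤ β) (hβ : β < 1) :
    wasserstein G (lazyMeasure G ω β x) (lazyMeasure G ω β y) ≤
      (1 - β) / (1 - α) * wasserstein G (lazyMeasure G ω α x) (lazyMeasure G ω α y) +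
        (1 - (1 - β) / (1 - α)) * G.dist x y := by
  classical
  have hα : 0 < 1 - α := by linarith
  have hθ : 0 < (1 - β) / (1 - α) := div_pos (by linarith) hα
  have hθ1 : (1 - β) / (1 - α) ≤ 1 := by rw [div_le_one hα]; linarith
  have hθα : (1 - β) / (1 - α) * (1 - α) = 1 - β := div_mul_cancel₀ _ hα.ne'
  set θ := (1 - β) / (1 - α) with hθdef
  have hm : ∀ z u, θ * lazyMeasure G ω α z u + (1 - θ) * (if u = z then 1 else 0) =
      lazyMeasure G ω β z u := by
    intro z u
    rw [lazyMeasure_eq, lazyMeasure_eq]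
    linear_combination (weight G ω z u / wdeg G ω z - if u = z then 1 else 0) * hθα
  suffices h : (wasserstein G (lazyMeasure G ω β x) (lazyMeasure G ω β y) -
      (1 - θ) * G.dist x y) / θ ≤
        wasserstein G (lazyMeasure G ω α x) (lazyMeasure G ω α y) by
    rw [div_le_iff₀ hθ] at h
    linarith
  refine le_wasserstein G (lazyMeasure_nonneg hω h0 (by linarith) x)
    (lazyMeasure_nonneg hω h0 (by linarith) y) (sum_lazyMeasure hG hω α hxy)
    (sum_lazyMeasure hG hω α hxy.symm) fun A hA => ?_
  rw [div_le_iff₀ hθ]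
  have hB : IsTransportPlan (lazyMeasure G ω β x) (lazyMeasure G ω β y)
      (fun u v => θ * A u v + (1 - θ) * ((if u = x then 1 else 0) * (if v = y then 1 else 0))) := by
    refine ⟨fun u v => add_nonneg (mul_nonneg hθ.le (hA.nonneg u v))
      (mul_nonneg (by linarith) (by positivity)), fun u => ?_, fun v => ?_⟩
    · rw [Finset.sum_add_distrib, ← Finset.mul_sum, hA.fst, ← Finset.mul_sum, ← Finset.mul_sum,
        ← hm]
      simp
    · rw [Finset.sum_add_distrib, ← Finset.mul_sum, hA.snd, ← Finset.mul_sum, ← Finset.sum_mul,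
        ← hm]
      simp
  have hle := wasserstein_le G hB
  have hcost : cost G (fun u v => θ * A u v +
      (1 - θ) * ((if u = x then 1 else 0) * (if v = y then 1 else 0))) =
        θ * cost G A + (1 - θ) * G.dist x y := by
    unfold cost
    simp only [mul_add, Finset.sum_add_distrib, Finset.mul_sum]
    congr 1
    · refine Finset.sum_congr rfl fun u _ => Finset.sum_congr rfl fun v _ => by ring
    · simp [mul_comm]
  rw [hcost] at hle
  linarith

lemma le_wasserstein_lazy {G : SimpleGraph V} {ω : G.edgeSet → ℝ} (hG : G.Connected)
    (hω : ∀ e, 0 < ω e) {x y : V} (hxy : x ≠ y) {α : ℝ} (h0 : 0 ≤ α) (h1 : α ≤ 1) :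
    α * G.dist x y - (1 - α) * ∑ v, weight G ω y v / wdeg G ω y * G.dist v y ≤
      wasserstein G (lazyMeasure G ω α x) (lazyMeasure G ω α y) := by
  classical
  refine le_wasserstein G (lazyMeasure_nonneg hω h0 h1 x)
    (lazyMeasure_nonneg hω h0 h1 y) (sum_lazyMeasure hG hω α hxy)
    (sum_lazyMeasure hG hω α hxy.symm) fun A hA => ?_
  have e1 : α * (G.dist x y : ℝ) ≤ ∑ u, ∑ v, (G.dist u y : ℝ) * A u v := by
    have hx : ∑ v, (G.dist x y : ℝ) * A x v = α * G.dist x y := by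
      rw [← Finset.mul_sum, hA.fst, lazyMeasure, if_pos rfl, mul_comm]
    rw [← hx]
    exact Finset.single_le_sum (f := fun u => ∑ v, (G.dist u y : ℝ) * A u v)
      (fun u _ => Finset.sum_nonneg fun v _ => mul_nonneg (Nat.cast_nonneg _) (hA.nonneg u v))
      (Finset.mem_univ x)
  have e2 : ∑ u, ∑ v, (G.dist v y : ℝ) * A u v =
      (1 - α) * ∑ v, weight G ω y v / wdeg G ω y * G.dist v y := by
    rw [Finset.sum_comm, Finset.mul_sum]
    refine Finset.sum_congr rfl fun v _ => ?_
    rw [← Finset.mul_sum, hA.snd, lazyMeasure_eq]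
    split_ifs with h
    · subst h
      simp
    · ring
  have e3 : ∑ u, ∑ v, (G.dist u y : ℝ) * A u v ≤
      cost G A + ∑ u, ∑ v, (G.dist v y : ℝ) * A u v := by
    unfold cost
    simp only [← Finset.sum_add_distrib, ← add_mul]
    refine Finset.sum_le_sum fun u _ => Finset.sum_le_sum fun v _ =>
      mul_le_mul_of_nonneg_right ?_ (hA.nonneg u v)
    exact_mod_cast hG.dist_triangle
  linarith

lemma tendsto_curvatureQuotient {G : SimpleGraph V} {ω : G.edgeSet → ℝ} (hG : G.Connected)
    (hω : ∀ e, 0 < ω e) {x y : V} (hxy : x ≠ y) :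
    Tendsto (curvatureQuotient G ω x y) (𝓝[<] 1) (𝓝 (curvature G ω x y)) := by
  have hd : (0 : ℝ) < G.dist x y := by exact_mod_cast hG.pos_dist_of_ne hxy
  refine tendsto_nhds_limUnder ⟨_, MonotoneOn.tendsto_nhdsWithin_Ioo_left
    (x := (1 : ℝ)) (y := 0) (Mf := ?_) ⟨1 / 2, by norm_num, by norm_num⟩ ?_⟩
  · rintro α ⟨h0, h1⟩ β ⟨-, hβ⟩ hαβ
    have h := wasserstein_lazy_le hG hω hxy h0.le hαβ hβ
    have hα' : 0 < 1 - α := by linarith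
    have hβ' : 0 < 1 - β := by linarith
    unfold curvatureQuotient
    rw [one_div_mul_eq_div, one_div_mul_eq_div, le_div_iff₀ hβ', ← sub_nonneg]
    have e : (1 - wasserstein G (lazyMeasure G ω β x) (lazyMeasure G ω β y) / (G.dist x y : ℝ)) -
        (1 - wasserstein G (lazyMeasure G ω α x) (lazyMeasure G ω α y) / (G.dist x y : ℝ)) /
          (1 - α) * (1 - β) =
        ((1 - β) / (1 - α) * wasserstein G (lazyMeasure G ω α x) (lazyMeasure G ω α y) +
        (1 - (1 - β) / (1 - α)) * G.dist x y -
        wasserstein G (lazyMeasure G ω β x) (lazyMeasure G ω β y)) / G.dist x y := by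
      field_simp
      ring
    rw [e]
    exact div_nonneg (by linarith) hd.le
  · refine ⟨1 + (∑ v, weight G ω y v / wdeg G ω y * G.dist v y) / G.dist x y, ?_⟩
    rintro _ ⟨α, ⟨h0, h1⟩, rfl⟩
    have h := le_wasserstein_lazy hG hω hxy h0.le h1.le
    have hα' : 0 < 1 - α := by linarith
    unfold curvatureQuotient
    rw [one_div_mul_eq_div, div_le_iff₀ hα', ← mul_le_mul_iff_of_pos_right hd]
    have e1 : (1 - wasserstein G (lazyMeasure G ω α x) (lazyMeasure G ω α y) / (G.dist x y : ℝ)) *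
        G.dist x y = G.dist x y - wasserstein G (lazyMeasure G ω α x) (lazyMeasure G ω α y) := by
      field_simp
    have e2 : (1 + (∑ v, weight G ω y v / wdeg G ω y * G.dist v y) / G.dist x y) * (1 - α) *
        G.dist x y = (1 - α) * G.dist x y +
          (1 - α) * ∑ v, weight G ω y v / wdeg G ω y * G.dist v y := by
      field_simp
    rw [e1, e2]
    linarith

end LinLuYau

/-! Let `p` be the transition probabilities of the walk. Across an edge xy of a graph of girth at
least six, every other neighbour of x is at distance 3 from every other neighbour of y. An explicit
plan and a potential then give the same transport cost, so that κ_xy = 2(p(x,y) + p(y,x)) - 2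
(`curvature_eq_of_adj`). In the coordinates u = log ω, p(x,·) is the Gibbs vector of u on the edges
at x, and κ = 2 ∑ₓ gibbsₓ(u) - 2 (`edgeCurvature_exp`). This is the gradient of the convex function
2 ∑ₓ log ∑_{e∋x} exp(u_e) - 2 ∑ u_e. The flow becomes u' = -(κ(u) - κ*), with a bounded, globally
Lipschitz right side; hence global existence and uniqueness.

The total mass of a Gibbs vector does not depend on u, so ∑ u_e is conserved. Gibbs vectors ignore
additive constants, so the logarithm of an attaining weight can be translated to an equilibrium v on
the hyperplane of the initial value. In the directions of that hyperplane κ is strongly monotone on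
bounded sets (`exists_strongly_monotone`): the pairing dominates the squared differences over pairs
of edges sharing a vertex, and connectedness turns these into a Poincaré inequality.

Monotonicity alone keeps |u - v| from growing, so the orbit is bounded. One monotonicity constant
then serves for all times and gives exponential decay (`exists_exp_decay_of_isGibbsFlow`). The same
inequality shows that v is unique (`eq_of_sum_gibbs_eq`). -/

namespace LinLuYau

open Filter Topology

/-! ### Gibbs vectors: Lipschitz bound, strong monotonicity, Poincaré inequality. -/

section Gibbs

variable {ι X : Type*} [Fintype ι] [Fintype X]

/-- The Gibbs vector with energies `u` and reference weights `a`. -/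
noncomputable def gibbs (a u : ι → ℝ) (e : ι) : ℝ :=
  a e * Real.exp (u e) / ∑ f, a f * Real.exp (u f)

/-- In the degenerate case `a = 0` the convention 0/0 = 0 makes the Gibbs vector vanish, so the
estimates below need no nontriviality hypothesis. -/
lemma eq_zero_or_partition_pos {a : ι → ℝ} (ha : ∀ e, 0 ≤ a e) :
    a = 0 ∨ ∀ u : ι → ℝ, 0 < ∑ f, a f * Real.exp (u f) := by
  by_cases h : ∃ e, a e ≠ 0
  · right
    obtain ⟨e, he⟩ := h
    intro u
    exact Finset.sum_pos' (fun f _ => mul_nonneg (ha f) (Real.exp_pos _).le)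
      ⟨e, Finset.mem_univ e, mul_pos ((ha e).lt_of_ne' he) (Real.exp_pos _)⟩
  · left
    push Not at h
    exact funext h

lemma gibbs_zero (u : ι → ℝ) (e : ι) : gibbs 0 u e = 0 := by
  simp [gibbs]

lemma gibbs_nonneg {a : ι → ℝ} (ha : ∀ e, 0 ≤ a e) (u : ι → ℝ) (e : ι) : 0 ≤ gibbs a u e :=
  div_nonneg (mul_nonneg (ha e) (Real.exp_pos _).le)
    (Finset.sum_nonneg fun f _ => mul_nonneg (ha f) (Real.exp_pos _).le)

lemma gibbs_le_one {a : ι → ℝ} (ha : ∀ e, 0 ≤ a e) (u : ι → ℝ) (e : ι) : gibbs a u e ≤ 1 :=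
  div_le_one_of_le₀ (Finset.single_le_sum (f := fun f => a f * Real.exp (u f))
    (fun f _ => mul_nonneg (ha f) (Real.exp_pos _).le) (Finset.mem_univ e))
    (Finset.sum_nonneg fun f _ => mul_nonneg (ha f) (Real.exp_pos _).le)

lemma sum_gibbs_of_pos {a u : ι → ℝ} (h : 0 < ∑ f, a f * Real.exp (u f)) :
    ∑ e, gibbs a u e = 1 := by
  unfold gibbs
  rw [← Finset.sum_div, div_self h.ne']

lemma sum_gibbs_eq {a : ι → ℝ} (ha : ∀ e, 0 ≤ a e) (u v : ι → ℝ) :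
    ∑ e, gibbs a u e = ∑ e, gibbs a v e := by
  rcases eq_zero_or_partition_pos ha with rfl | h
  · simp [gibbs_zero]
  · rw [sum_gibbs_of_pos (h u), sum_gibbs_of_pos (h v)]

/-- The numerator loses at most a factor exp(-δ), and the partition function gains at most exp(δ).
-/
lemma exp_mul_gibbs_le {a : ι → ℝ} (ha : ∀ e, 0 ≤ a e) {u v : ι → ℝ} {δ : ℝ}
    (h : ∀ e, |u e - v e| ≤ δ) (e : ι) : Real.exp (-(2 * δ)) * gibbs a v e ≤ gibbs a u e := by
  rcases eq_zero_or_partition_pos ha with rfl | hZ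
  · simp [gibbs_zero]
  have h1 : Real.exp (-δ) * Real.exp (v e) ≤ Real.exp (u e) := by
    rw [← Real.exp_add]
    exact Real.exp_le_exp.2 (by linarith [(abs_le.1 (h e)).1])
  have h2 : ∑ f, a f * Real.exp (u f) ≤ Real.exp δ * ∑ f, a f * Real.exp (v f) := by
    rw [Finset.mul_sum]
    refine Finset.sum_le_sum fun f _ => ?_
    rw [mul_left_comm, ← Real.exp_add]
    exact mul_le_mul_of_nonneg_left
      (Real.exp_le_exp.2 (by linarith [(abs_le.1 (h f)).2])) (ha f)
  unfold gibbs
  rw [le_div_iff₀ (hZ u)]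
  calc Real.exp (-(2 * δ)) * (a e * Real.exp (v e) / ∑ f, a f * Real.exp (v f)) *
        ∑ f, a f * Real.exp (u f)
      ≤ Real.exp (-(2 * δ)) * (a e * Real.exp (v e) / ∑ f, a f * Real.exp (v f)) *
        (Real.exp δ * ∑ f, a f * Real.exp (v f)) := by
        refine mul_le_mul_of_nonneg_left h2 (mul_nonneg (Real.exp_pos _).le ?_)
        exact gibbs_nonneg ha v e
    _ = Real.exp (-δ) * Real.exp (v e) * a e := by
        have e1 : Real.exp (-δ) = Real.exp (-(2 * δ)) * Real.exp δ := by
          rw [← Real.exp_add]; ring_nf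
        rw [e1]
        field_simp [(hZ v).ne']
    _ ≤ Real.exp (u e) * a e := mul_le_mul_of_nonneg_right h1 (ha e)
    _ = a e * Real.exp (u e) := mul_comm _ _

lemma abs_gibbs_sub_le {a : ι → ℝ} (ha : ∀ e, 0 ≤ a e) {u v : ι → ℝ} {δ : ℝ}
    (h : ∀ e, |u e - v e| ≤ δ) (e : ι) : |gibbs a u e - gibbs a v e| ≤ 2 * δ := by
  have hδ : 0 ≤ δ := (abs_nonneg _).trans (h e)
  have h1 := exp_mul_gibbs_le ha h e
  have h2 := exp_mul_gibbs_le ha (fun f => (abs_sub_comm (v f) (u f)).trans_le (h f)) e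
  have h3 := Real.add_one_le_exp (-(2 * δ))
  have hu := gibbs_nonneg ha u e
  have hv := gibbs_nonneg ha v e
  have hu' := gibbs_le_one ha u e
  have hv' := gibbs_le_one ha v e
  rw [abs_le]
  constructor <;> nlinarith

lemma sq_mul_exp_le {m s t : ℝ} (hs : m ≤ s) (ht : m ≤ t) :
    Real.exp m * (s - t) ^ 2 ≤ (s - t) * (Real.exp s - Real.exp t) := by
  wlog hst : t ≤ s generalizing s t
  · have := this ht hs (le_of_not_ge hst)
    nlinarith
  have h1 : Real.exp s - Real.exp t = Real.exp t * (Real.exp (s - t) - 1) := by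
    rw [mul_sub, ← Real.exp_add]; ring_nf
  have h2 : s - t ≤ Real.exp (s - t) - 1 := by linarith [Real.add_one_le_exp (s - t)]
  have h3 : Real.exp m ≤ Real.exp t := Real.exp_le_exp.2 ht
  rw [h1]
  have h4 : Real.exp m * (s - t) ≤ Real.exp t * (Real.exp (s - t) - 1) :=
    mul_le_mul h3 h2 (by linarith) (Real.exp_pos _).le
  nlinarith [mul_le_mul_of_nonneg_left h4 (sub_nonneg.2 hst)]

lemma partition_le {a u : ι → ℝ} {M : ℝ} (ha1 : ∀ e, a e ≤ 1) (hu : ∀ e, |u e| ≤ M) :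
    ∑ f, a f * Real.exp (u f) ≤ (Fintype.card ι + 1) * Real.exp M := by
  calc ∑ f, a f * Real.exp (u f) ≤ ∑ _f : ι, Real.exp M := by
        refine Finset.sum_le_sum fun f _ => ?_
        have h1 : Real.exp (u f) ≤ Real.exp M := Real.exp_le_exp.2 (abs_le.1 (hu f)).2
        nlinarith [ha1 f, Real.exp_pos (u f)]
    _ = Fintype.card ι * Real.exp M := by simp
    _ ≤ _ := by nlinarith [Real.exp_pos M]

/-- Twice the pairing of `w` with a difference of two probability vectors, symmetrized. -/
lemma two_mul_sum_mul_sub {b c w : ι → ℝ} (hb : ∑ e, b e = 1) (hc : ∑ e, c e = 1) :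
    2 * ∑ e, w e * (b e - c e) = ∑ e, ∑ f, (w e - w f) * (b e * c f - c e * b f) := by
  have e1 : ∀ e, ∑ f, (w e - w f) * (b e * c f - c e * b f) =
      w e * b e - w e * c e - b e * (∑ f, w f * c f) + c e * ∑ f, w f * b f := by
    intro e
    have : ∀ f, (w e - w f) * (b e * c f - c e * b f) =
        w e * b e * c f - w e * c e * b f - b e * (w f * c f) + c e * (w f * b f) := by
      intro f; ring
    simp only [this, Finset.sum_add_distrib, Finset.sum_sub_distrib, ← Finset.mul_sum, hb, hc]
    ring
  rw [Finset.sum_congr rfl fun e _ => e1 e]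
  simp only [Finset.sum_add_distrib, Finset.sum_sub_distrib, ← Finset.sum_mul, hb, hc, mul_sub]
  ring

/-- With w = u - v, the symmetrized pairing is a sum over pairs of a_e a_f (w_e - w_f)(exp(u_e +
v_f) - exp(v_e + u_f)) / (Z_u Z_v). The two exponents differ by exactly w_e - w_f, so each term is
nonnegative and `sq_mul_exp_le` applies to it. The exponents are at least -2M and each partition
function is at most (n + 1) exp(M), which gives exp(-4M)/(n + 1)²; the 2 comes from the
symmetrization. -/
lemma gibbs_strongly_monotone {a u v : ι → ℝ} {M : ℝ} (ha : ∀ e, 0 ≤ a e) (ha1 : ∀ e, a e ≤ 1)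
    (hu : ∀ e, |u e| ≤ M) (hv : ∀ e, |v e| ≤ M) :
    Real.exp (-(4 * M)) / (2 * (Fintype.card ι + 1) ^ 2) *
      ∑ e, ∑ f, a e * a f * ((u e - v e) - (u f - v f)) ^ 2 ≤
        ∑ e, (u e - v e) * (gibbs a u e - gibbs a v e) := by
  rcases eq_zero_or_partition_pos ha with rfl | hZ
  · simp [gibbs_zero]
  have key := two_mul_sum_mul_sub (w := fun e => u e - v e)
    (sum_gibbs_of_pos (hZ u)) (sum_gibbs_of_pos (hZ v))
  suffices h : Real.exp (-(4 * M)) / (Fintype.card ι + 1) ^ 2 *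
      ∑ e, ∑ f, a e * a f * ((u e - v e) - (u f - v f)) ^ 2 ≤
        2 * ∑ e, (u e - v e) * (gibbs a u e - gibbs a v e) by
    have e1 : Real.exp (-(4 * M)) / (2 * ((Fintype.card ι : ℝ) + 1) ^ 2) =
      Real.exp (-(4 * M)) / ((Fintype.card ι : ℝ) + 1) ^ 2 / 2 := by field_simp
    rw [e1]
    linarith
  rw [key, Finset.mul_sum]
  refine Finset.sum_le_sum fun e _ => ?_
  rw [Finset.mul_sum]
  refine Finset.sum_le_sum fun f _ => ?_
  set Zu := ∑ f, a f * Real.exp (u f) with hZu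
  set Zv := ∑ f, a f * Real.exp (v f) with hZv
  have pu : 0 < Zu := hZ u
  have pv : 0 < Zv := hZ v
  have lu : Zu ≤ (Fintype.card ι + 1) * Real.exp M := partition_le ha1 hu
  have lv : Zv ≤ (Fintype.card ι + 1) * Real.exp M := partition_le ha1 hv
  have e1 : gibbs a u e * gibbs a v f - gibbs a v e * gibbs a u f =
      a e * a f * (Real.exp (u e + v f) - Real.exp (v e + u f)) / (Zu * Zv) := by
    unfold gibbs
    rw [← hZu, ← hZv, Real.exp_add, Real.exp_add]
    field_simp
  have e2 := sq_mul_exp_le (m := -(2 * M)) (s := u e + v f) (t := v e + u f)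
    (by linarith [(abs_le.1 (hu e)).1, (abs_le.1 (hv f)).1])
    (by linarith [(abs_le.1 (hv e)).1, (abs_le.1 (hu f)).1])
  have e3 : Zu * Zv ≤ (Fintype.card ι + 1) ^ 2 * Real.exp (2 * M) := by
    calc Zu * Zv ≤ ((Fintype.card ι + 1) * Real.exp M) * ((Fintype.card ι + 1) * Real.exp M) :=
          mul_le_mul lu lv pv.le (by positivity)
      _ = _ := by rw [two_mul, Real.exp_add]; ring
  have e4 : Real.exp (-(4 * M)) / ((Fintype.card ι : ℝ) + 1) ^ 2 ≤
      Real.exp (-(2 * M)) / (Zu * Zv) := by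
    rw [div_le_div_iff₀ (by positivity) (by positivity)]
    calc Real.exp (-(4 * M)) * (Zu * Zv)
        ≤ Real.exp (-(4 * M)) * ((Fintype.card ι + 1) ^ 2 * Real.exp (2 * M)) :=
          mul_le_mul_of_nonneg_left e3 (Real.exp_pos _).le
      _ = Real.exp (-(2 * M)) * (Fintype.card ι + 1) ^ 2 := by
          have : Real.exp (-(2 * M)) = Real.exp (-(4 * M)) * Real.exp (2 * M) := by
            rw [← Real.exp_add]; ring_nf
          rw [this]; ring
  rw [e1]
  calc Real.exp (-(4 * M)) / ((Fintype.card ι : ℝ) + 1) ^ 2 *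
        (a e * a f * (u e - v e - (u f - v f)) ^ 2)
      ≤ Real.exp (-(2 * M)) / (Zu * Zv) * (a e * a f * (u e - v e - (u f - v f)) ^ 2) :=
        mul_le_mul_of_nonneg_right e4
          (mul_nonneg (mul_nonneg (ha e) (ha f)) (sq_nonneg _))
    _ = a e * a f / (Zu * Zv) *
        (Real.exp (-(2 * M)) * (u e + v f - (v e + u f)) ^ 2) := by ring
    _ ≤ a e * a f / (Zu * Zv) * ((u e + v f - (v e + u f)) *
        (Real.exp (u e + v f) - Real.exp (v e + u f))) :=
        mul_le_mul_of_nonneg_left e2 (div_nonneg (mul_nonneg (ha e) (ha f)) (by positivity))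
    _ = _ := by ring

/-- A Poincaré inequality on the hyperplane of sum zero: the energy controls the `ℓ²` norm as soon
as only the constants have energy zero. -/
lemma exists_poincare {a : X → ι → ℝ} (ha : ∀ x e, 0 ≤ a x e)
    (hconn : ∀ w : ι → ℝ, (∀ x e f, a x e * a x f ≠ 0 → w e = w f) → ∀ e f, w e = w f) :
    ∃ c : ℝ, 0 < c ∧ ∀ w : ι → ℝ, ∑ e, w e = 0 →
      c * ∑ e, w e ^ 2 ≤ ∑ x, ∑ e, ∑ f, a x e * a x f * (w e - w f) ^ 2 := by
  set q : (ι → ℝ) → ℝ := fun w => ∑ x, ∑ e, ∑ f, a x e * a x f * (w e - w f) ^ 2 with hq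
  have hterm : ∀ (w : ι → ℝ) x e f, 0 ≤ a x e * a x f * (w e - w f) ^ 2 := fun w x e f =>
    mul_nonneg (mul_nonneg (ha x e) (ha x f)) (sq_nonneg _)
  have hq0 : ∀ w, 0 ≤ q w := fun w => Finset.sum_nonneg fun x _ => Finset.sum_nonneg fun e _ =>
    Finset.sum_nonneg fun f _ => hterm w x e f
  -- By homogeneity it suffices to bound the energy below on the unit sphere of the hyperplane,
  -- which is compact; there it is positive because a constant vector of sum zero vanishes.
  set S : Set (ι → ℝ) := {w | ∑ e, w e = 0 ∧ ∑ e, w e ^ 2 = 1} with hS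
  have hSc : IsCompact S := by
    refine Metric.isCompact_of_isClosed_isBounded ?_ ?_
    · exact (isClosed_eq (by fun_prop) continuous_const).inter
        (isClosed_eq (by fun_prop) continuous_const)
    · refine (Metric.isBounded_closedBall (x := (0 : ι → ℝ)) (r := 1)).subset ?_
      rintro w ⟨-, hw⟩
      rw [mem_closedBall_zero_iff, pi_norm_le_iff_of_nonneg zero_le_one]
      intro e
      rw [Real.norm_eq_abs, ← sq_le_one_iff_abs_le_one, ← hw]
      exact Finset.single_le_sum (f := fun e => w e ^ 2) (fun _ _ => sq_nonneg _)
        (Finset.mem_univ e)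
  have hqc : Continuous q := by fun_prop
  have hpos : ∀ w ∈ S, 0 < q w := by
    rintro w ⟨h0, h1⟩
    refine (hq0 w).lt_of_ne' fun h => ?_
    have hw := hconn w fun x e f hne => by
      have h2 := (Finset.sum_eq_zero_iff_of_nonneg fun x _ => Finset.sum_nonneg fun e _ =>
        Finset.sum_nonneg fun f _ => hterm w x e f).1 h x (Finset.mem_univ x)
      have h3 := (Finset.sum_eq_zero_iff_of_nonneg fun e _ =>
        Finset.sum_nonneg fun f _ => hterm w x e f).1 h2 e (Finset.mem_univ e)
      have h4 := (Finset.sum_eq_zero_iff_of_nonneg fun f _ => hterm w x e f).1 h3 f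
        (Finset.mem_univ f)
      have h5 := pow_eq_zero_iff (two_ne_zero) |>.1 ((mul_eq_zero.1 h4).resolve_left hne)
      linarith
    have hz : ∀ e, w e = 0 := by
      intro e
      have h6 : ∑ f, w f = Fintype.card ι * w e := by
        rw [Finset.sum_congr rfl fun f _ => hw f e]
        simp
      have : Nonempty ι := ⟨e⟩
      rw [h0, eq_comm, mul_eq_zero] at h6
      exact h6.resolve_left (Nat.cast_ne_zero.2 Fintype.card_ne_zero)
    simp [hz] at h1
  obtain ⟨c, hc, hcS⟩ : ∃ c : ℝ, 0 < c ∧ ∀ w ∈ S, c ≤ q w := by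
    -- The sphere is empty when `ι` has at most one element.
    rcases S.eq_empty_or_nonempty with h | h
    · exact ⟨1, one_pos, by simp [h]⟩
    · obtain ⟨w, hw, hmin⟩ := hSc.exists_isMinOn h hqc.continuousOn
      exact ⟨q w, hpos w hw, fun v hv => hmin hv⟩
  refine ⟨c, hc, fun w hw => ?_⟩
  have hN : 0 ≤ ∑ e, w e ^ 2 := Finset.sum_nonneg fun _ _ => sq_nonneg _
  rcases hN.eq_or_lt with hN | hN
  · rw [← hN, mul_zero]
    exact hq0 w
  have hr := Real.sq_sqrt hN.le
  set r := Real.sqrt (∑ e, w e ^ 2) with hrdef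
  have hr0 : 0 < r := Real.sqrt_pos.2 hN
  have hmem : (fun e => w e / r) ∈ S := by
    refine ⟨by rw [← Finset.sum_div, hw, zero_div], ?_⟩
    simp only [div_pow]
    rw [← Finset.sum_div, ← hr, div_self (by positivity)]
  have h := hcS _ hmem
  have e1 : q (fun e => w e / r) = q w / r ^ 2 := by
    simp only [hq, Finset.sum_div]
    refine Finset.sum_congr rfl fun x _ => Finset.sum_congr rfl fun e _ =>
      Finset.sum_congr rfl fun f _ => ?_
    field_simp
  rw [e1, le_div_iff₀ (by positivity), hr] at h
  exact h

/-- On bounded sets the total Gibbs map is strongly monotone in the directions of sum zero. -/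
lemma exists_strongly_monotone {a : X → ι → ℝ} (ha : ∀ x e, 0 ≤ a x e) (ha1 : ∀ x e, a x e ≤ 1)
    (hconn : ∀ w : ι → ℝ, (∀ x e f, a x e * a x f ≠ 0 → w e = w f) → ∀ e f, w e = w f) (M : ℝ) :
    ∃ c : ℝ, 0 < c ∧ ∀ u v : ι → ℝ, (∀ e, |u e| ≤ M) → (∀ e, |v e| ≤ M) → ∑ e, u e = ∑ e, v e →
      c * ∑ e, (u e - v e) ^ 2 ≤
        ∑ e, (u e - v e) * (∑ x, gibbs (a x) u e - ∑ x, gibbs (a x) v e) := by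
  obtain ⟨c, hc, h⟩ := exists_poincare ha hconn
  set k : ℝ := Real.exp (-(4 * M)) / (2 * (Fintype.card ι + 1) ^ 2) with hk
  have hk0 : 0 < k := by positivity
  refine ⟨k * c, mul_pos hk0 hc, fun u v hu hv huv => ?_⟩
  have h1 := h (fun e => u e - v e) (by rw [Finset.sum_sub_distrib, huv, sub_self])
  calc k * c * ∑ e, (u e - v e) ^ 2
      ≤ k * ∑ x, ∑ e, ∑ f, a x e * a x f * ((u e - v e) - (u f - v f)) ^ 2 := by
        rw [mul_assoc]
        exact mul_le_mul_of_nonneg_left h1 hk0.le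
    _ = ∑ x, k * ∑ e, ∑ f, a x e * a x f * ((u e - v e) - (u f - v f)) ^ 2 := Finset.mul_sum ..
    _ ≤ ∑ x, ∑ e, (u e - v e) * (gibbs (a x) u e - gibbs (a x) v e) :=
        Finset.sum_le_sum fun x _ => gibbs_strongly_monotone (ha x) (ha1 x) hu hv
    _ = _ := by
        rw [Finset.sum_comm]
        refine Finset.sum_congr rfl fun e _ => ?_
        rw [← Finset.sum_sub_distrib, Finset.mul_sum]

end Gibbs

/-! ### Lipschitz vector fields: uniqueness and global existence. -/

open Set in
/-- Solutions on `[0, ∞)` of a Lipschitz vector field are determined by their initial value. -/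
theorem eq_of_solution_Ici {E : Type*} [NormedAddCommGroup E] [NormedSpace ℝ E] {F : E → E}
    {K : NNReal} (hK : LipschitzWith K F) {u v : ℝ → E}
    (hu : ∀ t, 0 ≤ t → HasDerivWithinAt u (F (u t)) (Ici 0) t)
    (hv : ∀ t, 0 ≤ t → HasDerivWithinAt v (F (v t)) (Ici 0) t) (h0 : u 0 = v 0) {t : ℝ}
    (ht : 0 ≤ t) : u t = v t :=
  ODE_solution_unique (v := fun _ => F) (K := K) (fun _ => hK)
    (fun s hs => (hu s hs.1).continuousWithinAt.mono Icc_subset_Ici_self)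
    (fun s hs => (hu s hs.1).mono (Ici_subset_Ici.2 hs.1))
    (fun s hs => (hv s hs.1).continuousWithinAt.mono Icc_subset_Ici_self)
    (fun s hs => (hv s hs.1).mono (Ici_subset_Ici.2 hs.1)) h0 ⟨ht, le_rfl⟩

section GlobalExistence

variable {E : Type*} [NormedAddCommGroup E] [NormedSpace ℝ E] [CompleteSpace E]

-- A field bounded by `L` moves a point at most `L * T` in time `T`; with a ball of that radius
-- Picard–Lindelöf covers the whole interval at once.
open Set in
lemma exists_solution_Icc {F : E → E} {K L : NNReal} (hK : LipschitzWith K F)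
    (hL : ∀ x, ‖F x‖ ≤ L) (x₀ : E) {T : ℝ} (hT : 0 ≤ T) :
    ∃ u : ℝ → E, u 0 = x₀ ∧ ∀ t ∈ Icc 0 T, HasDerivWithinAt u (F (u t)) (Icc 0 T) t :=
  IsPicardLindelof.exists_eq_forall_mem_Icc_hasDerivWithinAt₀ (t₀ := ⟨0, ⟨le_rfl, hT⟩⟩)
    (f := fun _ => F) (a := L * T.toNNReal) (L := L) (K := K)
    (.of_time_independent (fun x _ => hL x) hK.lipschitzOnWith (by simp [hT]))

open Set in
/-- A bounded Lipschitz vector field has a solution on `[0, ∞)` for every initial value. -/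
theorem exists_solution_Ici {F : E → E} {K L : NNReal} (hK : LipschitzWith K F)
    (hL : ∀ x, ‖F x‖ ≤ L) (x₀ : E) :
    ∃ u : ℝ → E, u 0 = x₀ ∧ ∀ t, 0 ≤ t → HasDerivWithinAt u (F (u t)) (Ici 0) t := by
  choose! φ hφ0 hφ using fun (T : ℝ) (hT : 0 ≤ T) => exists_solution_Icc hK hL x₀ hT
  have hright : ∀ {T t : ℝ}, 0 ≤ T → t ∈ Ico 0 T →
      HasDerivWithinAt (φ T) (F (φ T t)) (Ici t) t := by
    intro T t hT ht
    refine (hφ T hT t (Ico_subset_Icc_self ht)).mono_of_mem_nhdsWithin ?_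
    exact mem_of_superset (Icc_mem_nhdsGE ht.2) (Icc_subset_Icc_left ht.1)
  have hcont : ∀ {T : ℝ}, 0 ≤ T → ContinuousOn (φ T) (Icc 0 T) := fun hT t ht =>
    (hφ _ hT t ht).continuousWithinAt
  have hagree : ∀ {S T : ℝ}, 0 ≤ S → S ≤ T → ∀ t ∈ Icc 0 S, φ S t = φ T t := by
    intro S T hS hST
    have hT := hS.trans hST
    refine ODE_solution_unique (v := fun _ => F) (K := K) (fun _ => hK) (hcont hS)
      (fun t ht => hright hS ht) ((hcont hT).mono (Icc_subset_Icc_right hST))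
      (fun t ht => hright hT ⟨ht.1, ht.2.trans_le hST⟩) ?_
    rw [hφ0 S hS, hφ0 T hT]
  have hglue : ∀ {T : ℝ}, ∀ t ∈ Icc 0 T, φ t t = φ T t := fun t ht =>
    hagree ht.1 ht.2 t ⟨ht.1, le_rfl⟩
  -- By uniqueness the solutions on [0, T] are compatible, so the diagonal agrees with `φ (t + 1)`
  -- on [0, t + 1], a neighbourhood of `t` in [0, ∞).
  refine ⟨fun t => φ t t, hφ0 0 le_rfl, fun t ht => ?_⟩
  have hT : 0 ≤ t + 1 := by linarith
  have htT : t ∈ Icc 0 (t + 1) := ⟨ht, by linarith⟩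
  have h := (hφ (t + 1) hT t htT).congr (fun s hs => hglue s hs) (hglue t htT)
  rw [← hglue t htT] at h
  refine h.mono_of_mem_nhdsWithin ?_
  rw [← Ici_inter_Iic]
  exact inter_mem_nhdsWithin _ (Iic_mem_nhds (by linarith))

end GlobalExistence

/-! ### A Grönwall inequality. -/

section Decay

/-- The integrating factor exp(ct) makes the product antitone. No sign is imposed on `c`; the value
0 yields plain monotonicity. -/
lemma le_mul_exp_of_deriv_le {f f' : ℝ → ℝ} {c : ℝ}
    (hf : ∀ t, 0 ≤ t → HasDerivWithinAt f (f' t) (Set.Ici 0) t)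
    (hle : ∀ t, 0 ≤ t → f' t ≤ -(c * f t)) {t : ℝ} (ht : 0 ≤ t) :
    f t ≤ f 0 * Real.exp (-(c * t)) := by
  have hd : ∀ s, 0 ≤ s → HasDerivWithinAt (fun s => f s * Real.exp (c * s))
      ((f' s + c * f s) * Real.exp (c * s)) (Set.Ici 0) s := by
    intro s hs
    have h1 : HasDerivAt (fun s => Real.exp (c * s)) (Real.exp (c * s) * (c * 1)) s :=
      ((hasDerivAt_id s).const_mul c).exp
    exact ((hf s hs).mul h1.hasDerivWithinAt).congr_deriv (by ring)
  have hanti : AntitoneOn (fun s => f s * Real.exp (c * s)) (Set.Ici 0) := by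
    refine antitoneOn_of_hasDerivWithinAt_nonpos (convex_Ici 0)
      (fun s hs => (hd s hs).continuousWithinAt)
      (fun s hs => (hd s (interior_subset hs)).mono interior_subset) fun s hs => ?_
    exact mul_nonpos_of_nonpos_of_nonneg (by linarith [hle s (interior_subset hs)])
      (Real.exp_pos _).le
  have h := hanti (Set.mem_Ici.2 le_rfl) (Set.mem_Ici.2 ht) ht
  simp only [mul_zero, Real.exp_zero, mul_one] at h
  rw [Real.exp_neg, ← div_eq_mul_inv, le_div_iff₀ (Real.exp_pos _)]
  exact h

lemma eq_of_deriv_eq_zero {f : ℝ → ℝ} (hf : ∀ t, 0 ≤ t → HasDerivWithinAt f 0 (Set.Ici 0) t)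
    {t : ℝ} (ht : 0 ≤ t) : f t = f 0 := by
  refine le_antisymm ?_ ?_
  · simpa using le_mul_exp_of_deriv_le (c := 0) hf (by simp) ht
  · have hneg : ∀ t, 0 ≤ t → HasDerivWithinAt (fun t => -f t) (-0) (Set.Ici 0) t :=
      fun t ht => (hf t ht).neg
    simpa using le_mul_exp_of_deriv_le (c := 0) hneg (by simp) ht

end Decay

/-! ### The Gibbs flow and its convergence. -/

section GibbsFlow

variable {ι X : Type*} [Fintype ι] [Fintype X]

/-- The vector field of the flow `u' = -2 (∑ₓ gibbs (a x) u - ∑ₓ gibbs (a x) v)`. -/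
noncomputable def gibbsField (a : X → ι → ℝ) (v u : ι → ℝ) (e : ι) : ℝ :=
  -(2 * (∑ x, gibbs (a x) u e - ∑ x, gibbs (a x) v e))

lemma abs_sum_gibbs_sub_le {a : X → ι → ℝ} (ha : ∀ x e, 0 ≤ a x e) {u v : ι → ℝ} {δ : ℝ}
    (h : ∀ e, |u e - v e| ≤ δ) (e : ι) :
    |∑ x, gibbs (a x) u e - ∑ x, gibbs (a x) v e| ≤ Fintype.card X * (2 * δ) := by
  rw [← Finset.sum_sub_distrib]
  calc |∑ x, (gibbs (a x) u e - gibbs (a x) v e)|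
      ≤ ∑ x, |gibbs (a x) u e - gibbs (a x) v e| := Finset.abs_sum_le_sum_abs _ _
    _ ≤ ∑ _x : X, 2 * δ := Finset.sum_le_sum fun x _ => abs_gibbs_sub_le (ha x) h e
    _ = _ := by simp

lemma lipschitzWith_gibbsField {a : X → ι → ℝ} (ha : ∀ x e, 0 ≤ a x e) (v : ι → ℝ) :
    LipschitzWith (4 * Fintype.card X) (gibbsField a v) := by
  refine LipschitzWith.of_dist_le_mul fun u w => ?_
  have hK : 0 ≤ (((4 * Fintype.card X : NNReal)) : ℝ) * dist u w := by positivity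
  rw [dist_pi_le_iff hK]
  intro e
  have h := abs_sum_gibbs_sub_le ha (fun e => (dist_le_pi_dist u w e)) e
  have e1 : gibbsField a v u e - gibbsField a v w e =
      -(2 * (∑ x, gibbs (a x) u e - ∑ x, gibbs (a x) w e)) := by
    unfold gibbsField
    ring
  rw [Real.dist_eq, e1, abs_neg, abs_mul, abs_two]
  push_cast
  linarith

lemma norm_gibbsField_le {a : X → ι → ℝ} (ha : ∀ x e, 0 ≤ a x e) (v u : ι → ℝ) :
    ‖gibbsField a v u‖ ≤ ((2 * Fintype.card X : NNReal) : ℝ) := by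
  rw [pi_norm_le_iff_of_nonneg (by positivity)]
  intro e
  have hb : ∀ w : ι → ℝ, 0 ≤ ∑ x, gibbs (a x) w e ∧ ∑ x, gibbs (a x) w e ≤ Fintype.card X := by
    intro w
    refine ⟨Finset.sum_nonneg fun x _ => gibbs_nonneg (ha x) w e, ?_⟩
    calc ∑ x, gibbs (a x) w e ≤ ∑ _x : X, (1 : ℝ) :=
          Finset.sum_le_sum fun x _ => gibbs_le_one (ha x) w e
      _ = Fintype.card X := by simp
  unfold gibbsField
  push_cast
  rw [Real.norm_eq_abs, abs_le]
  constructor <;> linarith [(hb u).1, (hb u).2, (hb v).1, (hb v).2]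

/-- Each Gibbs vector has the same mass at `u` as at `v`. Hence the flow stays in a hyperplane of
constant sum. -/
lemma sum_gibbsField {a : X → ι → ℝ} (ha : ∀ x e, 0 ≤ a x e) (v u : ι → ℝ) :
    ∑ e, gibbsField a v u e = 0 := by
  unfold gibbsField
  rw [Finset.sum_neg_distrib, ← Finset.mul_sum, Finset.sum_sub_distrib, Finset.sum_comm,
    Finset.sum_comm (f := fun e x => gibbs (a x) v e),
    Finset.sum_congr rfl fun x _ => sum_gibbs_eq (ha x) u v]
  simp

lemma sum_eq_of_isGibbsFlow {a : X → ι → ℝ} (ha : ∀ x e, 0 ≤ a x e) {v : ι → ℝ}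
    {u : ℝ → ι → ℝ}
    (hu : ∀ t, 0 ≤ t → ∀ e, HasDerivWithinAt (fun s => u s e) (gibbsField a v (u t) e)
      (Set.Ici 0) t) {t : ℝ} (ht : 0 ≤ t) : ∑ e, u t e = ∑ e, u 0 e := by
  refine eq_of_deriv_eq_zero (f := fun t => ∑ e, u t e) (fun s hs => ?_) ht
  exact (HasDerivWithinAt.fun_sum fun e _ => hu s hs e).congr_deriv (sum_gibbsField ha v (u s))

/-- Solutions of the Gibbs flow converge exponentially to the equilibrium on the same hyperplane. -/
theorem exists_exp_decay_of_isGibbsFlow {a : X → ι → ℝ} (ha : ∀ x e, 0 ≤ a x e)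
    (ha1 : ∀ x e, a x e ≤ 1)
    (hconn : ∀ w : ι → ℝ, (∀ x e f, a x e * a x f ≠ 0 → w e = w f) → ∀ e f, w e = w f)
    {v : ι → ℝ} {u : ℝ → ι → ℝ}
    (hu : ∀ t, 0 ≤ t → ∀ e, HasDerivWithinAt (fun s => u s e) (gibbsField a v (u t) e)
      (Set.Ici 0) t) (hsum : ∑ e, u 0 e = ∑ e, v e) :
    ∃ C : ℝ, 0 < C ∧ ∃ r : ℝ, 0 < r ∧
      ∀ t, 0 ≤ t → ∀ e, |u t e - v e| ≤ C * Real.exp (-(r * t)) := by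
  set N : ℝ → ℝ := fun t => ∑ e, (u t e - v e) ^ 2 with hN
  set D : ℝ → ℝ := fun t =>
    ∑ e, (u t e - v e) * (∑ x, gibbs (a x) (u t) e - ∑ x, gibbs (a x) v e) with hD
  have hderiv : ∀ t, 0 ≤ t → HasDerivWithinAt N (-(4 * D t)) (Set.Ici 0) t := by
    intro t ht
    have h : HasDerivWithinAt N
        (∑ e, (2 : ℕ) * (u t e - v e) ^ (2 - 1) * gibbsField a v (u t) e) (Set.Ici 0) t :=
      HasDerivWithinAt.fun_sum fun e _ => ((hu t ht e).sub_const (v e)).fun_pow 2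
    convert h using 1
    rw [hD]
    simp only [Finset.mul_sum, ← Finset.sum_neg_distrib]
    refine Finset.sum_congr rfl fun e _ => ?_
    unfold gibbsField
    push_cast
    ring
  have hcoord : ∀ t e, (u t e - v e) ^ 2 ≤ N t := fun t e =>
    Finset.single_le_sum (f := fun e => (u t e - v e) ^ 2) (fun _ _ => sq_nonneg _)
      (Finset.mem_univ e)
  have hsum' : ∀ t, 0 ≤ t → ∑ e, u t e = ∑ e, v e := fun t ht =>
    (sum_eq_of_isGibbsFlow ha hu ht).trans hsum
  have hvM : ∀ e, |v e| ≤ ‖v‖ := fun e => norm_le_pi_norm v e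
  -- the energy is nonincreasing because the field is monotone, hence the orbit is bounded
  have hmono : ∀ t, 0 ≤ t → N t ≤ N 0 := by
    intro t ht
    have h := le_mul_exp_of_deriv_le (c := 0) hderiv (fun s hs => ?_) ht
    · simpa using h
    -- Here the constant depends on `s`; only the sign of `D s` is kept.
    · obtain ⟨c, hc, h⟩ := exists_strongly_monotone ha ha1 hconn (max ‖u s‖ ‖v‖)
      have h1 := h (u s) v (fun e => (norm_le_pi_norm (u s) e).trans (le_max_left _ _))
        (fun e => (norm_le_pi_norm v e).trans (le_max_right _ _)) (hsum' s hs)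
      have h2 : 0 ≤ c * N s := mul_nonneg hc.le (Finset.sum_nonneg fun _ _ => sq_nonneg _)
      have h3 : 0 ≤ D s := h2.trans h1
      linarith
  set R := Real.sqrt (N 0) with hR
  have hR0 : 0 ≤ R := Real.sqrt_nonneg _
  have hN0 : 0 ≤ N 0 := Finset.sum_nonneg fun _ _ => sq_nonneg _
  -- The ball of radius `‖v‖ + R` contains the entire orbit, so this constant is uniform in time.
  obtain ⟨c, hc, h⟩ := exists_strongly_monotone ha ha1 hconn (‖v‖ + R)
  have hdecay : ∀ t, 0 ≤ t → N t ≤ N 0 * Real.exp (-(4 * c * t)) := by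
    intro t ht
    refine le_mul_exp_of_deriv_le hderiv (fun s hs => ?_) ht
    have h1 : c * N s ≤ D s := by
      refine h (u s) v (fun e => ?_) (fun e => by linarith [hvM e]) (hsum' s hs)
      have h2 : |u s e - v e| ≤ R := Real.abs_le_sqrt ((hcoord s e).trans (hmono s hs))
      have h3 := abs_add_le (v e) (u s e - v e)
      rw [add_sub_cancel] at h3
      linarith [hvM e]
    linarith
  -- The square root halves the rate 4c of `N`; `R + 1` stays positive when the flow starts at
  -- equilibrium.
  refine ⟨R + 1, by linarith, 2 * c, by linarith, fun t ht e => ?_⟩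
  have h1 : |u t e - v e| ≤ R * Real.exp (-(2 * c * t)) := by
    refine abs_le_of_sq_le_sq ?_ (by positivity)
    rw [mul_pow, hR, Real.sq_sqrt hN0, ← Real.exp_nat_mul]
    refine (hcoord t e).trans ((hdecay t ht).trans_eq ?_)
    congr 2
    push_cast
    ring
  nlinarith [Real.exp_pos (-(2 * c * t))]

/-- Two equilibria of the Gibbs flow on the same hyperplane coincide. -/
theorem eq_of_sum_gibbs_eq {a : X → ι → ℝ} (ha : ∀ x e, 0 ≤ a x e) (ha1 : ∀ x e, a x e ≤ 1)
    (hconn : ∀ w : ι → ℝ, (∀ x e f, a x e * a x f ≠ 0 → w e = w f) → ∀ e f, w e = w f)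
    {u v : ι → ℝ} (h : ∀ e, ∑ x, gibbs (a x) u e = ∑ x, gibbs (a x) v e)
    (hsum : ∑ e, u e = ∑ e, v e) : u = v := by
  obtain ⟨c, hc, hmono⟩ := exists_strongly_monotone ha ha1 hconn (max ‖u‖ ‖v‖)
  have h1 := hmono u v (fun e => (norm_le_pi_norm u e).trans (le_max_left _ _))
    (fun e => (norm_le_pi_norm v e).trans (le_max_right _ _)) hsum
  simp only [h, sub_self, mul_zero, Finset.sum_const_zero] at h1
  funext e
  have h2 := Finset.single_le_sum (f := fun e => (u e - v e) ^ 2) (fun _ _ => sq_nonneg _)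
    (Finset.mem_univ e)
  have h3 : (u e - v e) ^ 2 ≤ 0 := by
    refine h2.trans ?_
    by_contra! h4
    nlinarith [mul_pos hc h4]
  have h5 : u e - v e = 0 := pow_eq_zero_iff two_ne_zero |>.1 (le_antisymm h3 (sq_nonneg _))
  linarith

end GibbsFlow

variable {V : Type*}

/-! ### Distances around an edge in girth at least six. -/

section Girth

variable {G : SimpleGraph V}

/-- The adjacency would close a triangle; the next two lemmas exclude 4-cycles and 5-cycles in the
same way. -/
lemma not_adj_of_common_neighbor (hgirth : 6 ≤ G.egirth) {x y z : V} (hxy : G.Adj x y)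
    (hyz : G.Adj y z) : ¬ G.Adj x z := by
  intro hxz
  have h := SimpleGraph.le_egirth.1 hgirth x
    (.cons hxy (.cons hyz (.cons hxz.symm .nil))) (by
      simp [SimpleGraph.Walk.cons_isCycle_iff, hxy.ne, hxy.ne', hyz.ne, hxz.ne, hxz.ne'])
  norm_num [SimpleGraph.Walk.length_cons] at h

lemma not_adj_of_path_length_three (hgirth : 6 ≤ G.egirth) {u x y v : V} (hux : G.Adj u x)
    (hxy : G.Adj x y) (hyv : G.Adj y v) (huy : u ≠ y) (hxv : x ≠ v) : ¬ G.Adj u v := by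
  intro huv
  have h := SimpleGraph.le_egirth.1 hgirth u
    (.cons hux (.cons hxy (.cons hyv (.cons huv.symm .nil)))) (by
      simp [SimpleGraph.Walk.cons_isCycle_iff, hux.ne, hux.ne', hxy.ne, hyv.ne, huv.ne,
        huv.ne', huy, huy.symm, hxv])
  norm_num [SimpleGraph.Walk.length_cons] at h

lemma not_adj_of_path_length_four (hgirth : 6 ≤ G.egirth) {u x y v z : V} (hux : G.Adj u x)
    (hxy : G.Adj x y) (hyv : G.Adj y v) (hvz : G.Adj v z) (huy : u ≠ y) (huv : u ≠ v)
    (hxv : x ≠ v) (hxz : x ≠ z) (hyz : y ≠ z) : ¬ G.Adj u z := by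
  intro huz
  have h := SimpleGraph.le_egirth.1 hgirth u
    (.cons hux (.cons hxy (.cons hyv (.cons hvz (.cons huz.symm .nil))))) (by
      simp [SimpleGraph.Walk.cons_isCycle_iff, hux.ne, hux.ne', hxy.ne, hyv.ne, hvz.ne,
        huz.ne, huz.ne', huy, huy.symm, huv, huv.symm, hxv, hxz, hyz])
  norm_num [SimpleGraph.Walk.length_cons] at h

lemma two_le_dist (hG : G.Connected) {u v : V} (hne : u ≠ v) (hadj : ¬ G.Adj u v) :
    2 ≤ G.dist u v := by
  have h0 := hG.pos_dist_of_ne hne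
  have h1 : G.dist u v ≠ 1 := fun h => hadj (SimpleGraph.dist_eq_one_iff_adj.1 h)
  omega

lemma three_le_dist (hG : G.Connected) {u v : V} (hne : u ≠ v) (hadj : ¬ G.Adj u v)
    (hcommon : ∀ z, G.Adj u z → ¬ G.Adj z v) : 3 ≤ G.dist u v := by
  have h2 := two_le_dist hG hne hadj
  by_contra! h3
  have h : G.dist u v = 2 := by omega
  obtain ⟨p, hp⟩ := hG.exists_walk_length_eq_dist u v
  rw [h] at hp
  match p, hp with
  | .cons h1 (.cons h2 .nil), _ => exact hcommon _ h1 h2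

/-- In girth at least six, the other neighbours of `x` and `y` are at distance three. -/
lemma three_le_dist_of_adj (hG : G.Connected) (hgirth : 6 ≤ G.egirth) {u x y v : V}
    (hux : G.Adj u x) (hxy : G.Adj x y) (hyv : G.Adj y v) (huy : u ≠ y) (hxv : x ≠ v) :
    3 ≤ G.dist u v := by
  have huv : u ≠ v := by
    rintro rfl
    exact not_adj_of_common_neighbor hgirth hxy hyv hux.symm
  refine three_le_dist hG huv (not_adj_of_path_length_three hgirth hux hxy hyv huy hxv)
    fun z huz hzv => ?_
  -- A midpoint `z` equal to `x` or `y` would give a triangle; any other one closes a 5-cycle.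
  have hxz : x ≠ z := by
    rintro rfl
    exact not_adj_of_common_neighbor hgirth hxy hyv hzv
  have hyz : y ≠ z := by
    rintro rfl
    exact not_adj_of_common_neighbor hgirth hux hxy huz
  exact not_adj_of_path_length_four hgirth hux hxy hyv hzv.symm huy huv hxv hxz hyz huz

end Girth

/-! ### The incidence matrix and connectedness. -/

section Incidence

variable {G : SimpleGraph V}

open Classical in
/-- The incidence matrix of `G`. -/
noncomputable def incidence (G : SimpleGraph V) (x : V) (e : G.edgeSet) : ℝ :=
  if x ∈ e.1 then 1 else 0

lemma incidence_nonneg (x : V) (e : G.edgeSet) : 0 ≤ incidence G x e := by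
  unfold incidence
  split_ifs <;> norm_num

lemma incidence_le_one (x : V) (e : G.edgeSet) : incidence G x e ≤ 1 := by
  unfold incidence
  split_ifs <;> norm_num

lemma incidence_ne_zero {x : V} {e : G.edgeSet} : incidence G x e ≠ 0 ↔ x ∈ e.1 := by
  simp [incidence]

/-- Successive edges of a walk share a vertex, so the common value propagates along it. This is the
connectedness hypothesis of `exists_poincare` for the rows of the incidence matrix. -/
lemma eq_of_incidence_connected (hG : G.Connected) {w : G.edgeSet → ℝ}
    (hw : ∀ x e f, incidence G x e * incidence G x f ≠ 0 → w e = w f) (e f : G.edgeSet) :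
    w e = w f := by
  have hshare : ∀ {x : V} {e f : G.edgeSet}, x ∈ e.1 → x ∈ f.1 → w e = w f := fun he hf =>
    hw _ _ _ (mul_ne_zero (incidence_ne_zero.2 he) (incidence_ne_zero.2 hf))
  have hwalk : ∀ {x y : V} (_ : G.Walk x y) (e f : G.edgeSet), x ∈ e.1 → y ∈ f.1 → w e = w f := by
    intro x y p
    induction p with
    | nil => exact fun e f he hf => hshare he hf
    | @cons x z y h p ih =>
      intro e f he hf
      exact (hshare (f := ⟨s(x, z), h⟩) he (Sym2.mem_mk_left x z)).trans
        (ih _ f (Sym2.mem_mk_right x z) hf)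
  have hmem : ∀ s : Sym2 V, ∃ x, x ∈ s := fun s => s.ind fun x y => ⟨x, Sym2.mem_mk_left x y⟩
  obtain ⟨x, hx⟩ := hmem e.1
  obtain ⟨y, hy⟩ := hmem f.1
  exact hwalk (hG.preconnected x y).some e f hx hy

end Incidence

/-! ### Optimal transport across an edge and the curvature formula. -/

variable [Fintype V] {G : SimpleGraph V} {ω : G.edgeSet → ℝ}

/-- The transition probability from `x` to `y` of the weighted random walk. -/
noncomputable def transition (G : SimpleGraph V) (ω : G.edgeSet → ℝ) (x y : V) : ℝ :=
  weight G ω x y / wdeg G ω x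

lemma transition_nonneg (hω : ∀ e, 0 < ω e) (x y : V) : 0 ≤ transition G ω x y :=
  div_nonneg (weight_nonneg hω x y) (Finset.sum_nonneg fun v _ => weight_nonneg hω x v)

lemma transition_eq_zero {x y : V} (h : ¬ G.Adj x y) : transition G ω x y = 0 := by
  simp [transition, weight, h]

lemma sum_transition (hG : G.Connected) (hω : ∀ e, 0 < ω e) {x y : V} (hxy : x ≠ y) :
    ∑ z, transition G ω x z = 1 := by
  unfold transition
  rw [← Finset.sum_div]
  exact div_self (wdeg_pos hG hω hxy).ne'

open Classical in
lemma lazyMeasure_eq_transition (α : ℝ) (x y : V) :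
    lazyMeasure G ω α x y = α * (if y = x then 1 else 0) + (1 - α) * transition G ω x y :=
  lazyMeasure_eq G ω α x y

open Classical in
lemma lazyMeasure_eq_zero {α : ℝ} {x y : V} (hne : y ≠ x) (hadj : ¬ G.Adj x y) :
    lazyMeasure G ω α x y = 0 := by
  simp [lazyMeasure_eq_transition, hne, transition_eq_zero hadj]

lemma IsTransportPlan.eq_zero_left {μ ν : V → ℝ} {A : V → V → ℝ} (h : IsTransportPlan μ ν A)
    {u : V} (hu : μ u = 0) (v : V) : A u v = 0 := by
  rw [← h.fst u] at hu
  exact (Finset.sum_eq_zero_iff_of_nonneg fun v _ => h.nonneg u v).1 hu v (Finset.mem_univ v)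

lemma IsTransportPlan.eq_zero_right {μ ν : V → ℝ} {A : V → V → ℝ} (h : IsTransportPlan μ ν A)
    {v : V} (hv : ν v = 0) (u : V) : A u v = 0 :=
  h.swap.eq_zero_left hv u

/-- Weak duality, for a potential that is `1`-Lipschitz along the supports. -/
lemma IsTransportPlan.le_cost {μ ν : V → ℝ} {A : V → V → ℝ} (h : IsTransportPlan μ ν A)
    {f : V → ℝ} (hf : ∀ u v, μ u ≠ 0 → ν v ≠ 0 → f u - f v ≤ G.dist u v) :
    ∑ u, f u * μ u - ∑ v, f v * ν v ≤ cost G A := by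
  have e1 : ∑ u, f u * μ u - ∑ v, f v * ν v = ∑ u, ∑ v, (f u - f v) * A u v := by
    simp only [sub_mul, Finset.sum_sub_distrib]
    congr 1
    · exact Finset.sum_congr rfl fun u _ => by rw [← h.fst u, Finset.mul_sum]
    · rw [Finset.sum_comm]
      exact Finset.sum_congr rfl fun v _ => by rw [← h.snd v, Finset.mul_sum]
  rw [e1]
  refine Finset.sum_le_sum fun u _ => Finset.sum_le_sum fun v _ => ?_
  -- The plan vanishes off the supports, where nothing is assumed about `f`.
  by_cases hu : μ u = 0
  · simp [h.eq_zero_left hu]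
  by_cases hv : ν v = 0
  · simp [h.eq_zero_right hv]
  exact mul_le_mul_of_nonneg_right (hf u v hu hv) (h.nonneg u v)

-- The plan sends the neighbours of x to y, spreads mass 1 - α from x over the neighbours of y, and
-- moves the remaining 2α - 1 from x to y; this is why α ≥ 1/2. A neighbour of x other than y is at
-- distance at most 2 from y, and symmetrically. This bound holds in any girth.
open Classical in
lemma wasserstein_lazy_le_of_adj (hG : G.Connected) (hω : ∀ e, 0 < ω e) {x y : V}
    (hxy : G.Adj x y) {α : ℝ} (h0 : 1 / 2 ≤ α) (h1 : α ≤ 1) :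
    wasserstein G (lazyMeasure G ω α x) (lazyMeasure G ω α y) ≤
      α + (1 - α) * (3 - 2 * transition G ω x y - 2 * transition G ω y x) := by
  set p := transition G ω x with hp
  set q := transition G ω y with hq
  have hp1 : ∑ z, p z = 1 := sum_transition hG hω hxy.ne
  have hq1 : ∑ z, q z = 1 := sum_transition hG hω hxy.ne'
  set A : V → V → ℝ := fun u v => (1 - α) * p u * (if v = y then 1 else 0) +
    (1 - α) * q v * (if u = x then 1 else 0) +
      (2 * α - 1) * ((if u = x then 1 else 0) * (if v = y then 1 else 0)) with hA
  have hplan : IsTransportPlan (lazyMeasure G ω α x) (lazyMeasure G ω α y) A := by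
    refine ⟨fun u v => ?_, fun u => ?_, fun v => ?_⟩
    · have := transition_nonneg hω x u
      have := transition_nonneg hω y v
      have h1' : 0 ≤ 1 - α := by linarith
      have h0' : 0 ≤ 2 * α - 1 := by linarith
      positivity
    · simp only [hA, lazyMeasure_eq_transition, Finset.sum_add_distrib, ← Finset.mul_sum,
        ← Finset.sum_mul, hq1]
      simp only [Finset.sum_ite_eq', Finset.mem_univ, if_true, ← hp]
      ring
    · simp only [hA, lazyMeasure_eq_transition, Finset.sum_add_distrib, ← Finset.mul_sum,
        ← Finset.sum_mul, hp1]
      simp only [Finset.sum_ite_eq', Finset.mem_univ, if_true, ← hq]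
      ring
  have hd : ∀ {s t u : V}, G.Adj s t → G.Adj s u → G.dist u t ≤ 2 * (1 - if u = t then 1 else 0) := by
    intro s t u hst hsu
    split_ifs with h
    · simp [h]
    · have h1 : G.dist u t ≤ G.dist u s + G.dist s t := hG.dist_triangle
      rw [SimpleGraph.dist_eq_one_iff_adj.2 hst, SimpleGraph.dist_eq_one_iff_adj.2 hsu.symm] at h1
      exact h1
  have hsum : ∀ {s t : V}, G.Adj s t →
      ∑ u, (G.dist u t : ℝ) * transition G ω s u ≤ 2 * (1 - transition G ω s t) := by
    intro s t hst
    calc ∑ u, (G.dist u t : ℝ) * transition G ω s u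
        ≤ ∑ u, 2 * (1 - if u = t then (1 : ℝ) else 0) * transition G ω s u := by
          refine Finset.sum_le_sum fun u _ => ?_
          by_cases hsu : G.Adj s u
          · refine mul_le_mul_of_nonneg_right ?_ (transition_nonneg hω s u)
            have := hd hst hsu
            split_ifs at this ⊢ with h
            · simp [h]
            · simpa using (by exact_mod_cast this : (G.dist u t : ℝ) ≤ 2)
          · simp [transition_eq_zero hsu]
      _ = 2 * (1 - transition G ω s t) := by
          simp only [mul_assoc, ← Finset.mul_sum, sub_mul, one_mul, Finset.sum_sub_distrib,
            sum_transition hG hω hst.ne]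
          simp
  refine (wasserstein_le G hplan).trans ?_
  have hcost : cost G A = (1 - α) * ∑ u, (G.dist u y : ℝ) * p u +
      (1 - α) * ∑ v, (G.dist v x : ℝ) * q v + (2 * α - 1) := by
    have hd1 : (G.dist x y : ℝ) = 1 := by rw [SimpleGraph.dist_eq_one_iff_adj.2 hxy, Nat.cast_one]
    have e1 : ∑ u, ∑ v, (G.dist u v : ℝ) * ((1 - α) * p u * (if v = y then 1 else 0)) =
        (1 - α) * ∑ u, (G.dist u y : ℝ) * p u := by
      rw [Finset.mul_sum]
      refine Finset.sum_congr rfl fun u _ => ?_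
      simp
      ring
    have e2 : ∑ u, ∑ v, (G.dist u v : ℝ) * ((1 - α) * q v * (if u = x then 1 else 0)) =
        (1 - α) * ∑ v, (G.dist v x : ℝ) * q v := by
      rw [Finset.sum_comm, Finset.mul_sum]
      refine Finset.sum_congr rfl fun v _ => ?_
      simp [G.dist_comm (u := x)]
      ring
    have e3 : ∑ u, ∑ v, (G.dist u v : ℝ) *
        ((2 * α - 1) * ((if u = x then 1 else 0) * (if v = y then 1 else 0))) = 2 * α - 1 := by
      simp [hd1]
    unfold cost
    simp only [hA, mul_add, Finset.sum_add_distrib, e1, e2, e3]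
  have s1 := mul_le_mul_of_nonneg_left (hsum hxy) (sub_nonneg.2 h1)
  have s2 := mul_le_mul_of_nonneg_left (hsum hxy.symm) (sub_nonneg.2 h1)
  rw [hcost]
  linarith

-- Duality with the potential that takes the values 3, 2, 1, 0 on the other neighbours of x, on x,
-- on y, and on the other neighbours of y. The girth makes the distances large enough for these
-- drops.
open Classical in
lemma le_wasserstein_lazy_of_adj (hG : G.Connected) (hgirth : 6 ≤ G.egirth)
    (hω : ∀ e, 0 < ω e) {x y : V} (hxy : G.Adj x y) {α : ℝ} (h0 : 0 ≤ α) (h1 : α ≤ 1) :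
    α + (1 - α) * (3 - 2 * transition G ω x y - 2 * transition G ω y x) ≤
      wasserstein G (lazyMeasure G ω α x) (lazyMeasure G ω α y) := by
  refine le_wasserstein G (lazyMeasure_nonneg hω h0 h1 x) (lazyMeasure_nonneg hω h0 h1 y)
    (sum_lazyMeasure hG hω α hxy.ne) (sum_lazyMeasure hG hω α hxy.ne') fun A hA => ?_
  set f : V → ℝ := fun u => if u = x then 2 else if u = y then 1 else if G.Adj x u then 3 else 0
    with hf
  have hfx : f x = 2 := by simp [hf]
  have hfy : f y = 1 := by simp [hf, hxy.ne']
  have hfx' : ∀ u, G.Adj x u → u ≠ y → f u = 3 := fun u hu huy => by simp [hf, hu, huy, hu.ne']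
  have hfy' : ∀ v, G.Adj y v → v ≠ x → f v = 0 := fun v hv hvx => by
    simp [hf, hvx, hv.ne', not_adj_of_common_neighbor hgirth hxy hv]
  have hdual := hA.le_cost (G := G) (f := f) fun u v hu hv => by
    have hu' : u = x ∨ G.Adj x u := by
      by_contra! h
      exact hu (lazyMeasure_eq_zero h.1 h.2)
    have hv' : v = y ∨ G.Adj y v := by
      by_contra! h
      exact hv (lazyMeasure_eq_zero h.1 h.2)
    have cast : ∀ n : ℕ, n ≤ G.dist u v → (n : ℝ) ≤ G.dist u v := fun _ h => by exact_mod_cast h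
    rcases hu' with rfl | hxu
    · by_cases hvu : v = u
      · simp [hvu]
      rcases hv' with rfl | hyv
      · have := cast 1 (hG.pos_dist_of_ne hxy.ne)
        rw [hfx, hfy]
        push_cast at this
        linarith
      · have := cast 2 (two_le_dist hG (Ne.symm hvu) (not_adj_of_common_neighbor hgirth hxy hyv))
        rw [hfx, hfy' v hyv hvu]
        push_cast at this
        linarith
    by_cases huv : u = v
    · simp [huv]
    have h1d := cast 1 (hG.pos_dist_of_ne huv)
    push_cast at h1d
    by_cases huy : u = y
    · subst huy
      by_cases hvx : v = x
      · rw [hvx, hfx, hfy]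
        linarith [Nat.cast_nonneg (α := ℝ) (G.dist u x)]
      · rw [hfy, hfy' v (hv'.resolve_left (Ne.symm huv)) hvx]
        linarith
    rw [hfx' u hxu huy]
    rcases hv' with rfl | hyv
    · have := cast 2 (two_le_dist hG huv (not_adj_of_common_neighbor hgirth hxu.symm hxy))
      rw [hfy]
      push_cast at this
      linarith
    by_cases hvx : v = x
    · subst hvx
      rw [hfx]
      linarith
    · have := cast 3 (three_le_dist_of_adj hG hgirth hxu.symm hxy hyv huy (Ne.symm hvx))
      rw [hfy' v hyv hvx]
      push_cast at this
      linarith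
  have hfp : ∀ u, f u * transition G ω x u =
      3 * transition G ω x u - 2 * ((if u = y then 1 else 0) * transition G ω x u) := by
    intro u
    by_cases hxu : G.Adj x u
    · by_cases huy : u = y
      · rw [huy, hfy, if_pos rfl]
        ring
      · rw [hfx' u hxu huy, if_neg huy]
        ring
    · simp [transition_eq_zero hxu]
  have hfq : ∀ v, f v * transition G ω y v =
      2 * ((if v = x then 1 else 0) * transition G ω y v) := by
    intro v
    by_cases hyv : G.Adj y v
    · by_cases hvx : v = x
      · rw [hvx, hfx, if_pos rfl]
        ring
      · rw [hfy' v hyv hvx, if_neg hvx]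
        ring
    · simp [transition_eq_zero hyv]
  have hsum : ∀ s, ∑ u, f u * lazyMeasure G ω α s u =
      α * f s + (1 - α) * ∑ u, f u * transition G ω s u := by
    intro s
    simp only [lazyMeasure_eq_transition, mul_add, Finset.sum_add_distrib, Finset.mul_sum]
    congr 1
    · simp [mul_comm]
    · exact Finset.sum_congr rfl fun u _ => by ring
  have hsx : ∑ u, f u * transition G ω x u = 3 - 2 * transition G ω x y := by
    simp only [hfp, Finset.sum_sub_distrib, ← Finset.mul_sum, sum_transition hG hω hxy.ne]
    simp
  have hsy : ∑ v, f v * transition G ω y v = 2 * transition G ω y x := by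
    simp only [hfq, ← Finset.mul_sum]
    simp
  rw [hsum, hsum, hsx, hsy, hfx, hfy] at hdual
  linarith

/-- On a graph of girth at least six the curvature of an edge is an explicit function of the
transition probabilities. -/
theorem curvature_eq_of_adj (hG : G.Connected) (hgirth : 6 ≤ G.egirth) (hω : ∀ e, 0 < ω e)
    {x y : V} (hxy : G.Adj x y) :
    curvature G ω x y = 2 * (transition G ω x y + transition G ω y x) - 2 := by
  refine tendsto_nhds_unique (tendsto_curvatureQuotient hG hω hxy.ne)
    (tendsto_const_nhds.congr' ?_)
  -- Both bounds agree for 1/2 < α < 1, so the quotient is already constant there.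
  filter_upwards [Ioo_mem_nhdsLT (show (1 / 2 : ℝ) < 1 by norm_num)] with α hα
  have hα0 : 1 / 2 ≤ α := hα.1.le
  have hα1 : (1 : ℝ) - α ≠ 0 := by linarith [hα.2]
  have hW := (wasserstein_lazy_le_of_adj hG hω hxy hα0 hα.2.le).antisymm
    (le_wasserstein_lazy_of_adj hG hgirth hω hxy (by linarith) hα.2.le)
  rw [curvatureQuotient, hW, SimpleGraph.dist_eq_one_iff_adj.2 hxy]
  field_simp
  ring

/-! ### Curvature in logarithmic coordinates. -/

variable [Fintype G.edgeSet]

lemma wdeg_eq_sum_incidence (x : V) : wdeg G ω x = ∑ e, incidence G x e * ω e := by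
  classical
  have h : ∀ e : G.edgeSet, incidence G x e * ω e = ∑ y, if e.1 = s(x, y) then ω e else 0 := by
    intro e
    unfold incidence
    split_ifs with hx
    · obtain ⟨z, hz⟩ := Sym2.mem_iff_exists.1 hx
      simp only [hz, Sym2.congr_right]
      simp
    · rw [zero_mul, Finset.sum_eq_zero fun y _ => if_neg fun hy => hx (by rw [hy]; simp)]
  rw [Finset.sum_congr rfl fun e _ => h e, Finset.sum_comm, wdeg]
  refine Finset.sum_congr rfl fun y _ => ?_
  unfold weight
  split_ifs with hxy
  · rw [Finset.sum_eq_single_of_mem (⟨s(x, y), hxy⟩ : G.edgeSet) (Finset.mem_univ _)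
      fun e _ he => if_neg fun h => he (Subtype.ext h)]
    simp
  · exact (Finset.sum_eq_zero fun e _ => if_neg fun h => hxy (by
      rw [← SimpleGraph.mem_edgeSet, ← h]; exact e.2)).symm

lemma gibbs_incidence {x y : V} (u : G.edgeSet → ℝ) (hxy : G.Adj x y) :
    gibbs (incidence G x) u ⟨s(x, y), hxy⟩ = transition G (fun e => Real.exp (u e)) x y := by
  simp [gibbs, transition, weight, wdeg_eq_sum_incidence, incidence, hxy]

/-- In logarithmic coordinates the curvature is a sum of Gibbs vectors. -/
theorem edgeCurvature_exp (hG : G.Connected) (hgirth : 6 ≤ G.egirth) (u : G.edgeSet → ℝ)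
    (e : G.edgeSet) :
    edgeCurvature G (fun e => Real.exp (u e)) e = 2 * ∑ x, gibbs (incidence G x) u e - 2 := by
  classical
  obtain ⟨s, he⟩ := e
  induction s using Sym2.ind with
  | _ x y =>
    have hxy : G.Adj x y := he
    -- Only the two endpoints of the edge contribute to the sum over vertices.
    have h0 : ∀ z, z ∉ ({x, y} : Finset V) → gibbs (incidence G z) u ⟨s(x, y), he⟩ = 0 := by
      intro z hz
      have : incidence G z ⟨s(x, y), he⟩ = 0 := by
        simpa [incidence] using hz
      simp [gibbs, this]
    have hyx : gibbs (incidence G y) u ⟨s(x, y), he⟩ =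
        transition G (fun e => Real.exp (u e)) y x := by
      rw [← gibbs_incidence u hxy.symm]
      congr 1
      exact Subtype.ext Sym2.eq_swap
    rw [← Finset.sum_subset (Finset.subset_univ {x, y}) fun z _ hz => h0 z hz,
      Finset.sum_pair hxy.ne, gibbs_incidence u hxy, hyx]
    exact curvature_eq_of_adj hG hgirth (fun e => Real.exp_pos (u e)) hxy

/-- This is the scale invariance of the curvature: it lets an attaining weight be normalized to the
prescribed sum of logarithms. -/
lemma gibbs_add_const {ι : Type*} [Fintype ι] (a u : ι → ℝ) (c : ℝ) (e : ι) :
    gibbs a (fun e => u e + c) e = gibbs a u e := by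
  unfold gibbs
  simp only [Real.exp_add, ← mul_assoc, ← Finset.sum_mul]
  exact mul_div_mul_right _ _ (Real.exp_pos c).ne'

lemma exists_add_const_sum_eq {ι : Type*} [Fintype ι] (u v : ι → ℝ) :
    ∃ c : ℝ, ∑ e, (u e + c) = ∑ e, v e := by
  rcases isEmpty_or_nonempty ι with h | h
  · exact ⟨0, by simp⟩
  · refine ⟨(∑ e, v e - ∑ e, u e) / Fintype.card ι, ?_⟩
    have : (Fintype.card ι : ℝ) ≠ 0 := Nat.cast_ne_zero.2 Fintype.card_ne_zero
    rw [Finset.sum_add_distrib, Finset.sum_const, Finset.card_univ, nsmul_eq_mul]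
    field_simp
    ring

lemma abs_exp_sub_exp_le {a b R δ : ℝ} (ha : a ≤ R) (hb : b ≤ R) (h : |a - b| ≤ δ) :
    |Real.exp a - Real.exp b| ≤ Real.exp R * δ := by
  have key : ∀ {s t : ℝ}, s ≤ R → |s - t| ≤ δ → Real.exp s - Real.exp t ≤ Real.exp R * δ := by
    intro s t hs hst
    have hδ : 0 ≤ δ := (abs_nonneg _).trans hst
    have h1 : Real.exp t = Real.exp s * Real.exp (t - s) := by
      rw [← Real.exp_add]
      ring_nf
    have h2 := Real.add_one_le_exp (t - s)
    calc Real.exp s - Real.exp t = Real.exp s * (1 - Real.exp (t - s)) := by rw [h1]; ring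
      _ ≤ Real.exp s * δ := mul_le_mul_of_nonneg_left
          (by linarith [(abs_le.1 hst).2]) (Real.exp_pos s).le
      _ ≤ Real.exp R * δ := mul_le_mul_of_nonneg_right (Real.exp_le_exp.2 hs) hδ
  rw [abs_sub_le_iff]
  exact ⟨key ha h, key hb (abs_sub_comm a b ▸ h)⟩

/-- Exponential convergence of logarithms gives exponential convergence. -/
lemma ConvergesExponentially.exp {ι : Type*} [Fintype ι] {u : ℝ → ι → ℝ} {v : ι → ℝ}
    (h : ConvergesExponentially u v) :
    ConvergesExponentially (fun t e => Real.exp (u t e)) (fun e => Real.exp (v e)) := by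
  obtain ⟨C, hC, r, hr, h⟩ := h
  refine ⟨Real.exp (‖v‖ + C) * C, by positivity, r, hr, fun t ht e => ?_⟩
  have hv : v e ≤ ‖v‖ := (le_abs_self _).trans (norm_le_pi_norm v e)
  have h1 : |u t e - v e| ≤ C := (h t ht e).trans
    (mul_le_of_le_one_right hC.le (Real.exp_le_one_iff.2 (neg_nonpos.2 (mul_nonneg hr.le ht))))
  rw [mul_assoc]
  exact abs_exp_sub_exp_le (by linarith [(abs_le.1 h1).2]) (by linarith) (h t ht e)

section Flow

variable {V : Type*} [Fintype V] {G : SimpleGraph V} [Fintype G.edgeSet]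

lemma edgeCurvature_eq (hG : G.Connected) (hgirth : 6 ≤ G.egirth) {ω : G.edgeSet → ℝ}
    (hω : ∀ e, 0 < ω e) (e : G.edgeSet) :
    edgeCurvature G ω e = 2 * ∑ x, gibbs (incidence G x) (fun e => Real.log (ω e)) e - 2 := by
  rw [← edgeCurvature_exp hG hgirth]
  simp only [Real.exp_log (hω _)]

lemma ConvergesExponentially.edgeCurvature (hG : G.Connected) (hgirth : 6 ≤ G.egirth)
    {u : ℝ → G.edgeSet → ℝ} {v : G.edgeSet → ℝ} (h : ConvergesExponentially u v) :
    ConvergesExponentially (fun t => edgeCurvature G (fun e => Real.exp (u t e)))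
      (LinLuYau.edgeCurvature G (fun e => Real.exp (v e))) := by
  obtain ⟨C, hC, r, hr, h⟩ := h
  -- The Lipschitz constant is 2 · 2|V|; the extra 1 gives slack.
  refine ⟨(4 * Fintype.card V + 1) * C, by positivity, r, hr, fun t ht e => ?_⟩
  have h1 := abs_sum_gibbs_sub_le (a := incidence G) incidence_nonneg (h t ht) e
  have h2 : 0 ≤ C * Real.exp (-(r * t)) := by positivity
  beta_reduce
  rw [edgeCurvature_exp hG hgirth, edgeCurvature_exp hG hgirth, sub_sub_sub_cancel_right,
    ← mul_sub, abs_mul, abs_two]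
  linarith

end Flow

end LinLuYau

/-! ### The main theorem. -/

/-- On a finite connected graph of girth at least `6` with attainable prescribed curvature `κ'`, for
every positive initial weight `ω₀` the flow has exactly one positive solution `ω` on `[0, ∞)`, there
is exactly one positive weight `ωs` with curvature `κ'` and `∑ log ωs = ∑ log ω₀`, the solution
converges to it exponentially, and its curvature converges exponentially to `κ'`. -/
theorem theorem3 {V : Type*} [Fintype V] (G : SimpleGraph V) [Fintype G.edgeSet]
    (hconn : G.Connected) (hgirth : 6 ≤ G.egirth)
    (κ' : G.edgeSet → ℝ) (hκ' : LinLuYau.IsAttainable G κ')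
    (ω₀ : G.edgeSet → ℝ) (hω₀ : ∀ e, 0 < ω₀ e) :
    ∃ ω : ℝ → G.edgeSet → ℝ,
      LinLuYau.IsRicciFlow G κ' ω₀ ω ∧
      (∀ ω' : ℝ → G.edgeSet → ℝ, LinLuYau.IsRicciFlow G κ' ω₀ ω' → ∀ t, 0 ≤ t → ω' t = ω t) ∧
      (∃ ωs : G.edgeSet → ℝ,
        (LinLuYau.Realizes G κ' ωs ∧ ∑ e, Real.log (ωs e) = ∑ e, Real.log (ω₀ e)) ∧
        (∀ ω' : G.edgeSet → ℝ, LinLuYau.Realizes G κ' ω' →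
          ∑ e, Real.log (ω' e) = ∑ e, Real.log (ω₀ e) → ω' = ωs) ∧
        LinLuYau.ConvergesExponentially ω ωs) ∧
      LinLuYau.ConvergesExponentially (fun t => LinLuYau.edgeCurvature G (ω t)) κ' := by
  open LinLuYau in
  obtain ⟨ω₁, hω₁, hκ₁⟩ := hκ'
  obtain ⟨c, hc⟩ := exists_add_const_sum_eq (fun e => Real.log (ω₁ e)) (fun e => Real.log (ω₀ e))
  -- The equilibrium: the logarithm of the attaining weight, translated to the hyperplane of log ω₀.
  set v : G.edgeSet → ℝ := fun e => Real.log (ω₁ e) + c with hv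
  have hκv : ∀ e, κ' e = 2 * ∑ x, gibbs (incidence G x) v e - 2 := by
    intro e
    rw [← hκ₁ e, edgeCurvature_eq hconn hgirth hω₁]
    simp only [hv, gibbs_add_const]
  have hκexp : edgeCurvature G (fun e => Real.exp (v e)) = κ' := by
    funext e
    rw [edgeCurvature_exp hconn hgirth, hκv]
  have hlip := lipschitzWith_gibbsField (a := incidence G) incidence_nonneg v
  obtain ⟨u, hu0, hu⟩ := exists_solution_Ici hlip
    (norm_gibbsField_le incidence_nonneg v) (fun e => Real.log (ω₀ e))
  have hu' : ∀ t, 0 ≤ t → ∀ e, HasDerivWithinAt (fun s => u s e)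
      (gibbsField (incidence G) v (u t) e) (Set.Ici 0) t := fun t ht =>
    hasDerivWithinAt_pi.1 (hu t ht)
  have hconv : ConvergesExponentially u v :=
    exists_exp_decay_of_isGibbsFlow incidence_nonneg incidence_le_one
      (fun _ hw => eq_of_incidence_connected hconn hw) hu' (by rw [hu0, hc])
  refine ⟨fun t e => Real.exp (u t e), ⟨?_, fun t _ e => Real.exp_pos _, fun t ht e => ?_⟩,
    fun ω hω t ht => ?_, ⟨fun e => Real.exp (v e), ⟨⟨fun e => Real.exp_pos _, congrFun hκexp⟩, ?_⟩,
    fun ω hω hsum => ?_, hconv.exp⟩, ?_⟩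
  · simp only [hu0, Real.exp_log (hω₀ _)]
  · refine (hu' t ht e).exp.congr_deriv ?_
    rw [edgeCurvature_exp hconn hgirth, hκv, gibbsField]
    ring
  -- Taking logarithms cancels the factor ω_e, so every positive solution becomes a solution of the
  -- same Lipschitz equation.
  · have hlog : ∀ t, 0 ≤ t → HasDerivWithinAt (fun s e => Real.log (ω s e))
        (gibbsField (incidence G) v (fun e => Real.log (ω t e))) (Set.Ici 0) t := by
      intro t ht
      refine hasDerivWithinAt_pi.2 fun e => ?_
      refine ((hω.deriv t ht e).log (hω.pos t ht e).ne').congr_deriv ?_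
      rw [mul_div_cancel_right₀ _ (hω.pos t ht e).ne', edgeCurvature_eq hconn hgirth (hω.pos t ht),
        hκv, gibbsField]
      ring
    have h := eq_of_solution_Ici hlip hlog hu (by rw [hω.init, hu0]) ht
    funext e
    exact (Real.exp_log (hω.pos t ht e)).symm.trans (congrArg Real.exp (congrFun h e))
  · simp only [Real.log_exp, hc]
  · have h : (fun e => Real.log (ω e)) = v := by
      refine eq_of_sum_gibbs_eq (a := incidence G) incidence_nonneg incidence_le_one
        (fun _ hw => eq_of_incidence_connected hconn hw) (fun e => ?_) (hsum.trans hc.symm)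
      have h1 := hω.2 e
      rw [edgeCurvature_eq hconn hgirth hω.1, hκv] at h1
      linarith
    funext e
    rw [← congrFun h e, Real.exp_log (hω.1 e)]
  · have h := hconv.edgeCurvature hconn hgirth
    rwa [hκexp] at h
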